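/- Let $\kappa$ be a weakly compact cardinal, meaning here that $\kappa$ is strongly inaccessible (in particular uncountable) and has the tree property: every tree of height $\kappa$ all of whose levels have cardinality less than $\kappa$ has a branch of length $\kappa$. Let $\mathbb{B}$ be a complete Boolean algebra. For ordinals $\lambda,\mu$ call $\mathbb{B}$ $(\lambda,\mu)$-distributive if $$\prod_{\alpha<\lambda}\sum_{\beta<\mu}u_{\alpha,\beta}=\sum_{f:\lambda\to\mu}\ \prod_{\alpha<\lambda}u_{\alpha,f(\alpha)}$$ for every family $\langle u_{\alpha,\beta}\in\mathbb{B}:\alpha<\lambda,\ \beta<\mu\rangle$, and weakly $(\lambda,\mu)$-distributive if $$\prod_{\alpha<\lambda}\sum_{\beta<\mu}u_{\alpha,\beta}=\sum_{g:\lambda\to\mu}\ \prod_{\alpha<\lambda}\ \sum_{\beta<g(\alpha)}u_{\alpha,\beta}$$ for every such family. If $\mathbb{B}$ is weakly $(2^\kappa,\kappa)$-distributive (where $2^\kappa$ is the cardinal power) and $\mathbb{B}$ is $(\alpha,2)$-distributive for every ordinal $\alpha<\kappa$, then $\mathbb{B}$ is $(\kappa,2)$-distributive. -/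

import Mathlib

universe u v w

namespace WeakDistributivity

section Distributivity

variable (B : Type v) [CompleteBooleanAlgebra B]

/-- `B` is `(l, k)`-distributive, for ordinals `l` and `k`. An ordinal `l` is represented, as a set,
by `Set.Iio l`, the set of ordinals below it. -/
def IsDistributive (l : Ordinal.{u}) (k : Ordinal.{w}) : Prop :=
  ∀ a : Set.Iio l → Set.Iio k → B,
    ⨅ i, ⨆ j, a i j = ⨆ f : Set.Iio l → Set.Iio k, ⨅ i, a i (f i)

/-- `B` is weakly `(l, k)`-distributive, for ordinals `l` and `k`. -/
def IsWeaklyDistributive (l : Ordinal.{u}) (k : Ordinal.{w}) : Prop :=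
  ∀ a : Set.Iio l → Set.Iio k → B,
    ⨅ i, ⨆ j, a i j =
      ⨆ g : Set.Iio l → Set.Iio k, ⨅ i, ⨆ (j : Set.Iio k) (_ : j < g i), a i j

end Distributivity

/-- A (set-theoretic) tree: a partially ordered set in which the set of strict predecessors of each
element is well ordered. -/
class IsTree (T : Type u) [PartialOrder T] : Prop where
  wellOrder_Iio (x : T) : IsWellOrder (Set.Iio x) (· < ·)

attribute [instance] IsTree.wellOrder_Iio

section Tree

variable {T : Type u} [PartialOrder T] [IsTree T]

/-- The height of `x` in a tree: the order type of its set of strict predecessors. -/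
noncomputable def treeHeight (x : T) : Ordinal.{u} :=
  Ordinal.type (α := Set.Iio x) (· < ·)

variable (T) in
/-- The level `o` of a tree: the set of its elements of height `o`. -/
def level (o : Ordinal.{u}) : Set T :=
  {x | treeHeight x = o}

variable (T) in
/-- A `κ`-tree: a tree of height `κ` all of whose levels have fewer than `κ` elements. The first two
fields say that the levels below `κ` are nonempty and that there are no others. -/
structure IsCardinalTree (κ : Cardinal.{u}) : Prop where
  level_nonempty (o : Ordinal.{u}) (ho : o < κ.ord) : (level T o).Nonempty
  treeHeight_lt (x : T) : treeHeight x < κ.ord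
  card_level_lt (o : Ordinal.{u}) (ho : o < κ.ord) : Cardinal.mk (level T o) < κ

/-- A path of length `κ` through a tree: a chain that meets every level below `κ`. -/
def IsCofinalBranch (κ : Cardinal.{u}) (b : Set T) : Prop :=
  IsChain (· ≤ ·) b ∧ ∀ o < κ.ord, (b ∩ level T o).Nonempty

end Tree

/-- The tree property: every `κ`-tree has a path of length `κ`. -/
def TreeProperty (κ : Cardinal.{u}) : Prop :=
  ∀ (T : Type u) [PartialOrder T] [IsTree T],
    IsCardinalTree T κ → ∃ b : Set T, IsCofinalBranch κ b

/-- Weakly compact: strongly inaccessible (in particular uncountable) with the tree property. -/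
structure IsWeaklyCompact (κ : Cardinal.{u}) : Prop where
  isInaccessible : κ.IsInaccessible
  treeProperty : TreeProperty κ

end WeakDistributivity

/-! Read a family `c` in `B` as a name for a subset `A` of `κ`; it suffices that `A` is decided to
be a ground-model set densely often. If not, below some nonzero condition `A` differs from every
`s`. Weak distributivity, applied to the `2 ^ κ` many `s`, bounds the first difference: some nonzero
`p` and some `g` put it below `g s` for every `s`. The initial segments of `A` that `p` does not
exclude form a `κ`-tree: levels are nonempty by distributivity below `κ`, and small since `κ` is a
strong limit. A branch gives an `s` that `p` never excludes, contradicting the bound `g s`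
(`iSup_literal_eq_top`). -/

namespace WeakDistributivity

/-! ### Trees of bounded approximations -/

section SetTree

variable {K : Type u} [LinearOrder K]

/-- A node `(a, s)` of the tree of approximations to subsets of `K`: the set `s` is a subset of the
initial segment `Set.Iio a`, and satisfies `P a`. -/
@[ext]
structure SetNode (P : K → Set K → Prop) where
  /-- The length of the approximation. -/
  bound : K
  /-- The approximation. -/
  set : Set K
  subset_Iio : set ⊆ Set.Iio bound
  prop : P bound set

namespace SetNode

variable {P : K → Set K → Prop}

instance : PartialOrder (SetNode P) where
  le x y := x.bound ≤ y.bound ∧ x.set = y.set ∩ Set.Iio x.bound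
  le_refl x := ⟨le_rfl, (Set.inter_eq_left.2 x.subset_Iio).symm⟩
  le_trans x y z hxy hyz := by
    refine ⟨hxy.1.trans hyz.1, ?_⟩
    rw [hxy.2, hyz.2, Set.inter_assoc, Set.Iio_inter_Iio, min_eq_right hxy.1]
  le_antisymm x y hxy hyx := by
    have hb := le_antisymm hxy.1 hyx.1
    refine SetNode.ext hb ?_
    rw [hxy.2, hb, Set.inter_eq_left.2 y.subset_Iio]

theorem le_def {x y : SetNode P} :
    x ≤ y ↔ x.bound ≤ y.bound ∧ x.set = y.set ∩ Set.Iio x.bound :=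
  Iff.rfl

theorem bound_lt_of_lt {x y : SetNode P} (h : x < y) : x.bound < y.bound := by
  refine lt_of_le_of_ne h.le.1 fun hb => h.ne (SetNode.ext hb ?_)
  rw [(le_def.1 h.le).2, hb, Set.inter_eq_left.2 y.subset_Iio]

/-- `P` is inherited by the restrictions of a set to shorter initial segments. -/
def IsHereditary (P : K → Set K → Prop) : Prop :=
  ∀ ⦃a b : K⦄ ⦃s t : Set K⦄, b ≤ a → s ∩ Set.Iio b = t ∩ Set.Iio b → P a s → P b t

/-- The restriction of a node to a shorter initial segment. -/
def restrict (hP : IsHereditary P) (x : SetNode P) (b : K) (hb : b ≤ x.bound) : SetNode P where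
  bound := b
  set := x.set ∩ Set.Iio b
  subset_Iio := Set.inter_subset_right
  prop := hP hb (by rw [Set.inter_assoc, Set.inter_self]) x.prop

/-- The predecessors of a node are its restrictions. -/
def iioRelIso (hP : IsHereditary P) (x : SetNode P) :
    ((· < ·) : Set.Iio x → Set.Iio x → Prop) ≃r
      ((· < ·) : Set.Iio x.bound → Set.Iio x.bound → Prop) where
  toFun y := ⟨y.1.bound, bound_lt_of_lt y.2⟩
  invFun b := ⟨x.restrict hP b.1 (le_of_lt b.2), lt_of_le_of_ne (le_def.2 ⟨le_of_lt b.2, rfl⟩)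
    fun h => (ne_of_lt b.2) (congrArg bound h)⟩
  left_inv y := by
    have hy : y.1 < x := y.2
    exact Subtype.ext (SetNode.ext rfl (le_def.1 hy.le).2.symm)
  right_inv b := rfl
  map_rel_iff' := by
    intro y z
    have hy : y.1 < x := y.2
    have hz : z.1 < x := z.2
    refine ⟨fun h => ?_, fun h => bound_lt_of_lt h⟩
    have hb : y.1.bound < z.1.bound := h
    refine lt_of_le_of_ne (α := SetNode P) ⟨hb.le, ?_⟩ fun h => hb.ne (congrArg bound h)
    rw [(le_def.1 hy.le).2, (le_def.1 hz.le).2, Set.inter_assoc, Set.Iio_inter_Iio,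
      min_eq_right hb.le]

variable [WellFoundedLT K]

theorem isTree (hP : IsHereditary P) : IsTree (SetNode P) where
  wellOrder_Iio x := (iioRelIso hP x).toRelEmbedding.isWellOrder

theorem treeHeight_eq [IsTree (SetNode P)] (hP : IsHereditary P) (x : SetNode P) :
    treeHeight x = Ordinal.typein ((· < ·) : K → K → Prop) x.bound :=
  (iioRelIso hP x).ordinalType_congr

end SetNode

/-- In a well-order of type `κ`, where `κ` is a strong limit cardinal with the tree property, a
hereditary property of bounded approximations that holds for some approximation of each length
holds for all the restrictions of a single set. -/
theorem TreeProperty.exists_set [WellFoundedLT K] {κ : Cardinal.{u}} (hκ : TreeProperty κ)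
    (hlim : κ.IsStrongPrelimit) (hK : Ordinal.type ((· < ·) : K → K → Prop) = κ.ord)
    {P : K → Set K → Prop} (hP : SetNode.IsHereditary P) (hne : ∀ a, ∃ s, P a s) :
    ∃ s, ∀ a, P a s := by
  have : IsTree (SetNode P) := SetNode.isTree hP
  have hlt (a : K) : Ordinal.typein ((· < ·) : K → K → Prop) a < κ.ord :=
    hK ▸ Ordinal.typein_lt_type _ a
  have hsurj {o : Ordinal.{u}} (ho : o < κ.ord) :
      ∃ a, Ordinal.typein ((· < ·) : K → K → Prop) a = o :=
    Ordinal.typein_surj _ (hK.symm ▸ ho)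
  have hT : IsCardinalTree (SetNode P) κ := by
    refine ⟨fun o ho => ?_, fun x => ?_, fun o ho => ?_⟩
    · obtain ⟨a, rfl⟩ := hsurj ho
      obtain ⟨s, hs⟩ := hne a
      exact ⟨⟨a, s ∩ Set.Iio a, Set.inter_subset_right,
        hP le_rfl (by rw [Set.inter_assoc, Set.inter_self]) hs⟩, SetNode.treeHeight_eq hP _⟩
    · rw [SetNode.treeHeight_eq hP]
      exact hlt _
    · obtain ⟨a, rfl⟩ := hsurj ho
      have hb (x : level (SetNode P) (Ordinal.typein ((· < ·) : K → K → Prop) a)) :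
          x.1.bound = a := by
        have hx : treeHeight x.1 = _ := x.2
        rwa [SetNode.treeHeight_eq hP, Ordinal.typein_inj] at hx
      -- A level embeds in the power set of an initial segment, which the strong limit property
      -- bounds.
      let F (x : level (SetNode P) (Ordinal.typein ((· < ·) : K → K → Prop) a)) :
          Set (Set.Iio a) := Subtype.val ⁻¹' x.1.set
      have hF : Function.Injective F := by
        intro x y hxy
        refine Subtype.ext (SetNode.ext ((hb x).trans (hb y).symm) ?_)
        rw [Subtype.preimage_coe_eq_preimage_coe_iff] at hxy
        have hsub (z : level (SetNode P) (Ordinal.typein ((· < ·) : K → K → Prop) a)) :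
            z.1.set ⊆ Set.Iio a := z.1.subset_Iio.trans_eq (congrArg Set.Iio (hb z))
        rwa [Set.inter_eq_right.2 (hsub x), Set.inter_eq_right.2 (hsub y)] at hxy
      refine (Cardinal.mk_le_of_injective hF).trans_lt ?_
      rw [Cardinal.mk_set]
      exact hlim (Cardinal.lt_ord.1 (hlt a))
  obtain ⟨b, hchain, hb⟩ := hκ (SetNode P) hT
  have hb' (a : K) : ∃ x ∈ b, x.bound = a := by
    obtain ⟨x, hxb, hx⟩ := hb _ (hlt a)
    have hx' : treeHeight x = _ := hx
    rw [SetNode.treeHeight_eq hP, Ordinal.typein_inj] at hx'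
    exact ⟨x, hxb, hx'⟩
  refine ⟨⋃ x ∈ b, x.set, fun a => ?_⟩
  obtain ⟨x, hxb, rfl⟩ := hb' a
  refine hP le_rfl ?_ x.prop
  refine Set.Subset.antisymm (fun i hi => ⟨Set.mem_biUnion hxb hi.1, hi.2⟩) ?_
  rintro i ⟨hi, hia⟩
  obtain ⟨y, hyb, hiy⟩ := Set.mem_iUnion₂.1 hi
  refine ⟨?_, hia⟩
  rcases hchain.total hxb hyb with h | h
  · rw [(SetNode.le_def.1 h).2]
    exact ⟨hiy, hia⟩
  · rw [(SetNode.le_def.1 h).2] at hiy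
    exact hiy.1

/-- The form of `TreeProperty.exists_set` for subsets of the set of ordinals below `κ`. -/
theorem TreeProperty.exists_set_Iio {κ : Cardinal.{u}} (hκ : TreeProperty κ)
    (hlim : κ.IsStrongPrelimit) {P : Set.Iio κ.ord → Set (Set.Iio κ.ord) → Prop}
    (hP : ∀ ⦃a b s t⦄, b ≤ a → (∀ i < b, i ∈ s ↔ i ∈ t) → P a s → P b t)
    (hne : ∀ a, ∃ s, P a s) : ∃ s, ∀ a, P a s := by
  -- `Set.Iio κ.ord` lies one universe too high for `TreeProperty κ`; `κ.ord.ToType` is its copy in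
  -- `Type u`.
  let e : Set.Iio κ.ord ≃o κ.ord.ToType := Ordinal.ToType.mk
  obtain ⟨s, hs⟩ := hκ.exists_set hlim (Ordinal.type_toType κ.ord)
    (P := fun a s => P (e.symm a) (e ⁻¹' s))
    (fun a b s t hba hst => hP (e.symm.monotone hba) fun i hi => by
      have h := Set.ext_iff.1 hst (e i)
      have hib : e i ∈ Set.Iio b := e.lt_symm_apply.1 hi
      simpa [hib] using h)
    (fun a => by
      obtain ⟨s, hs⟩ := hne (e.symm a)
      refine ⟨e.symm ⁻¹' s, ?_⟩
      have h : e ⁻¹' (e.symm ⁻¹' s) = s := by ext; simp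
      rwa [h])
  exact ⟨e ⁻¹' s, fun a => by simpa using hs (e a)⟩

end SetTree

/-! ### Boolean values of membership -/

section Literal

variable {B : Type v} [CompleteBooleanAlgebra B] {I : Type w}

open Classical in
/-- The Boolean value of `i ∈ A ↔ i ∈ s`, where `c` is the name of a set `A`. -/
noncomputable def literal (c : I → B) (s : Set I) (i : I) : B :=
  if i ∈ s then c i else (c i)ᶜ

theorem literal_congr (c : I → B) {s t : Set I} {i : I} (h : i ∈ s ↔ i ∈ t) :
    literal c s i = literal c t i := by
  unfold literal
  congr 1
  exact propext h

theorem literal_of_mem (c : I → B) {s : Set I} {i : I} (h : i ∈ s) : literal c s i = c i :=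
  if_pos h

theorem literal_of_notMem (c : I → B) {s : Set I} {i : I} (h : i ∉ s) :
    literal c s i = (c i)ᶜ :=
  if_neg h

end Literal

/-! ### Distributivity and deciding names -/

section Distributivity

variable {B : Type v} [CompleteBooleanAlgebra B]

theorem Iio_two_eq (j : Set.Iio (2 : Ordinal.{u})) :
    j = ⟨0, Set.mem_Iio.2 zero_lt_two⟩ ∨ j = ⟨1, Set.mem_Iio.2 one_lt_two⟩ := by
  obtain ⟨j, hj⟩ := j
  rcases lt_or_ge j 1 with h | h
  · exact Or.inl (Subtype.ext (Order.lt_one_iff.1 h))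
  · refine Or.inr (Subtype.ext (le_antisymm ?_ h))
    exact Order.lt_add_one_iff.1 (hj.trans_eq one_add_one_eq_two.symm)

/-- Two-valued distributivity, restricted to an initial segment. -/
theorem IsDistributive.iSup_literal_Iio {l : Ordinal.{u}} (c : Set.Iio l → B) (a : Set.Iio l)
    (h : IsDistributive B a.1 (2 : Ordinal.{w})) :
    (⨆ s : Set (Set.Iio l), ⨅ i, ⨅ _ : i < a, literal c s i) = ⊤ := by
  classical
  let r (i : Set.Iio a.1) : Set.Iio l := ⟨i.1, lt_trans (show i.1 < a.1 from i.2) a.2⟩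
  have h' := h fun i j => if j.1 = 0 then c (r i) else (c (r i))ᶜ
  refine top_le_iff.1 (le_trans (top_le_iff.2 ?_) (h'.le.trans ?_))
  · refine iInf_eq_top.2 fun i => top_le_iff.1 ?_
    rw [← sup_compl_eq_top (x := c (r i))]
    refine sup_le ?_ ?_
    · exact le_iSup_of_le ⟨0, Set.mem_Iio.2 zero_lt_two⟩ (by simp)
    · exact le_iSup_of_le ⟨1, Set.mem_Iio.2 one_lt_two⟩ (by simp)
  · refine iSup_le fun f => ?_
    let s : Set (Set.Iio l) := {i | ∃ hi : i < a, (f ⟨i.1, hi⟩).1 = 0}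
    refine le_iSup_of_le s ?_
    refine le_iInf₂ fun i hi => iInf_le_of_le ⟨i.1, hi⟩ ?_
    by_cases h0 : (f ⟨i.1, hi⟩).1 = 0
    · have hs : i ∈ s := ⟨hi, h0⟩
      exact (if_pos h0).le.trans_eq (literal_of_mem c hs).symm
    · have hs : i ∉ s := fun ⟨_, h⟩ => h0 h
      exact (if_neg h0).le.trans_eq (literal_of_notMem c hs).symm

/-- Two-valued distributivity follows from the decidability of names of sets. -/
theorem isDistributive_two_of_iSup_literal {l : Ordinal.{u}}
    (h : ∀ c : Set.Iio l → B, (⨆ s : Set (Set.Iio l), ⨅ i, literal c s i) = ⊤) :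
    IsDistributive B l (2 : Ordinal.{w}) := by
  classical
  intro a
  refine le_antisymm ?_ (iSup_le fun f => iInf_mono fun i => le_iSup (a i) (f i))
  -- Decide the set of rows where column 0 holds; in the other rows column 1 must hold.
  rw [← inf_top_eq (⨅ i, ⨆ j, a i j), ← h fun i => a i ⟨0, Set.mem_Iio.2 zero_lt_two⟩, inf_iSup_eq]
  refine iSup_le fun s => le_iSup_of_le
    (fun i => if i ∈ s then ⟨0, Set.mem_Iio.2 zero_lt_two⟩ else ⟨1, Set.mem_Iio.2 one_lt_two⟩)
    (le_iInf fun i => ?_)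
  refine (inf_le_inf (iInf_le _ i) (iInf_le _ i)).trans ?_
  by_cases hi : i ∈ s
  · simp only [literal_of_mem _ hi, if_pos hi]
    exact inf_le_right
  · simp only [literal_of_notMem _ hi, if_neg hi]
    rw [← sdiff_eq, sdiff_le_iff]
    refine iSup_le fun j => ?_
    rcases Iio_two_eq j with rfl | rfl
    · exact le_sup_left
    · exact le_sup_right

/-- Weak distributivity, for families indexed by an arbitrary type of the right cardinality. -/
theorem IsWeaklyDistributive.iInf_iSup_eq {l : Ordinal.{u}} {k : Ordinal.{w}}
    (h : IsWeaklyDistributive B l k) {I : Type*} (e : Set.Iio l ≃ I) (a : I → Set.Iio k → B) :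
    ⨅ i, ⨆ j, a i j =
      ⨆ g : I → Set.Iio k, ⨅ i, ⨆ (j : Set.Iio k) (_ : j < g i), a i j := by
  have h' := h fun i j => a (e i) j
  rw [e.iInf_comp (g := fun i => ⨆ j, a i j)] at h'
  rw [h', ← (e.arrowCongr (Equiv.refl (Set.Iio k))).iSup_comp]
  refine iSup_congr fun g => ?_
  rw [← e.iInf_comp]
  simp

theorem nonempty_Iio_two_power_ord_equiv (κ : Cardinal.{u}) :
    Nonempty (Set.Iio ((2 : Cardinal.{u}) ^ κ).ord ≃ Set (Set.Iio κ.ord)) := by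
  rw [← Cardinal.eq, Cardinal.mk_set, Cardinal.mk_Iio_ordinal, Cardinal.mk_Iio_ordinal,
    Cardinal.card_ord, Cardinal.card_ord, Cardinal.lift_power, Cardinal.lift_ofNat]

/-- Every name of a subset of `κ` is decided by a dense set of conditions. -/
theorem iSup_literal_eq_top {κ : Cardinal.{u}} (hκ : IsWeaklyCompact κ)
    (hweak : IsWeaklyDistributive B ((2 : Cardinal.{u}) ^ κ).ord κ.ord)
    (hdist : ∀ α : Ordinal.{u}, α < κ.ord → IsDistributive B α (2 : Ordinal.{u}))
    (c : Set.Iio κ.ord → B) :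
    (⨆ s : Set (Set.Iio κ.ord), ⨅ i, literal c s i) = ⊤ := by
  by_contra hne
  obtain ⟨e⟩ := nonempty_Iio_two_power_ord_equiv κ
  have hw := hweak.iInf_iSup_eq e fun s i => (literal c s i)ᶜ
  have hw0 : (⨅ s : Set (Set.Iio κ.ord), ⨆ i, (literal c s i)ᶜ) ≠ ⊥ := by
    simpa only [← compl_iInf, ← compl_iSup, ne_eq, compl_eq_bot] using hne
  rw [hw] at hw0
  obtain ⟨g, hg⟩ : ∃ g : Set (Set.Iio κ.ord) → Set.Iio κ.ord,
      (⨅ s, ⨆ (i : Set.Iio κ.ord) (_ : i < g s), (literal c s i)ᶜ) ≠ ⊥ := by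
    by_contra! h
    exact hw0 (iSup_eq_bot.2 h)
  set p := ⨅ s, ⨆ (i : Set.Iio κ.ord) (_ : i < g s), (literal c s i)ᶜ
  obtain ⟨s, hs⟩ := hκ.treeProperty.exists_set_Iio hκ.isInaccessible.isStrongPrelimit
    (P := fun a s => (p ⊓ ⨅ i, ⨅ _ : i < a, literal c s i) ≠ ⊥)
    (fun a b s t hba hst h => by
      refine ne_bot_of_le_ne_bot h (inf_le_inf_left _ (le_iInf₂ fun i hi => ?_))
      rw [← literal_congr c (hst i hi)]
      exact iInf₂_le_of_le i (hi.trans_le hba) le_rfl)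
    (fun a => by
      by_contra! h
      refine hg ?_
      rw [← inf_top_eq p, ← IsDistributive.iSup_literal_Iio c a (hdist a.1 a.2), inf_iSup_eq]
      exact iSup_eq_bot.2 h)
  -- At length `g s`, `p` is compatible with `A` agreeing with `s`, yet lies below the complement of
  -- that agreement.
  refine hs (g s) (disjoint_iff.1 (Disjoint.mono_left (iInf_le _ s) ?_))
  simp only [← compl_iInf]
  exact disjoint_compl_left

end Distributivity

end WeakDistributivity

theorem mainTheorem2 (B : Type v) [CompleteBooleanAlgebra B] (κ : Cardinal.{u})
    (hκ : WeakDistributivity.IsWeaklyCompact κ)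
    (hweak : WeakDistributivity.IsWeaklyDistributive B ((2 : Cardinal.{u}) ^ κ).ord κ.ord)
    (hdist : ∀ α : Ordinal.{u}, α < κ.ord →
      WeakDistributivity.IsDistributive B α (2 : Ordinal.{u})) :
    WeakDistributivity.IsDistributive B κ.ord (2 : Ordinal.{u}) :=
  WeakDistributivity.isDistributive_two_of_iSup_literal
    (WeakDistributivity.iSup_literal_eq_top hκ hweak hdist)
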